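/- **Definitions.** Let $X$ be a totally ordered set; "sorted" means non-increasing. A sequence $\langle v_1,\dots,v_n\rangle\in X^n$ is *top $k$ sorted* if $k\le n$, $v_1\ge\dots\ge v_k$, and $v_a\ge v_b$ whenever $a\le k<b\le n$. Let $c,k\in\mathbb N$ with $k\ge 1$ and $k/4\le c$, and put $k_i=\min(c,\lfloor k/i\rfloor)$ for $1\le i\le 4$. A tuple $\langle\bar w,\bar x,\bar y,\bar z\rangle\in X^{k_1}\times X^{k_2}\times X^{k_3}\times X^{k_4}$ is *4-wise of order $(c,k)$* if each of the four sequences is sorted and $w_j\ge x_j$ for $j\le k_2$, $x_j\ge y_j$ for $j\le k_3$, $y_j\ge z_j$ for $j\le k_4$. For $m\ge 1$, $\mathit{sort}^m(u_1,\dots,u_m)$ rearranges the values stored at the places $u_1,\dots,u_m$ so that $u_1\ge\dots\ge u_m$ afterwards; places that do not exist are left out. **The 4-Wise Merging Network** $4w\_merge^s_{(c,k)}$, where $s=k_1+k_2+k_3+k_4$, acts on the entries of $\langle\bar w,\bar x,\bar y,\bar z\rangle$ as follows. Let $d=\min\{l\in\mathbb N : 2^l\ge k_1\}$. An upper bound that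 is not positive makes a range of $j$ empty. *Slope sorting.* For $i=1,\dots,d$, with $h=h_i=2^{d-i}$: 1. for all $1\le j\le\min(k_3-h,k_4)$: if $j+3h\le k_1$ and $j+2h\le k_2$, do $\mathit{sort}^4(z_j,y_{j+h},x_{j+2h},w_{j+3h})$; otherwise, if $j+2h\le k_2$, do $\mathit{sort}^3(z_j,y_{j+h},x_{j+2h})$; otherwise do $\mathit{sort}^2(z_j,y_{j+h})$; 2. for all $1\le j\le\min(k_2-h,k_3,h)$: if $j+2h\le k_1$, do $\mathit{sort}^3(y_j,x_{j+h},w_{j+2h})$; otherwise do $\mathit{sort}^2(y_j,x_{j+h})$; 3. for all $1\le j\le\min(k_1-h,k_2,h)$: do $\mathit{sort}^2(x_j,w_{j+h})$. *Correction.* Then: 1. for all $1\le j\le\min(k_1-2,k_4)$: $\mathit{sort}^2(z_j,w_{j+2})$; 2. for all $1\le j\le\min(k_2-1,k_4)$: $\mathit{sort}^4(y_j,z_j,w_{j+1},x_{j+1})$; 3. if $k_1>k_4$ and $k_2=k_4$: $\mathit{sort}^3(y_{k_4},z_{k_4},w_{k_4+1})$; 4. if $k\bmod 4=3$ and $k_1>k_4+1$: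 $\mathit{sort}^2(y_{k_4+1},w_{k_4+2})$. *Output.* The sequence of length $s$ that lists the four resulting columns $\bar w,\bar x,\bar y,\bar z$ in row-major order, $\langle w_1,x_1,y_1,z_1,w_2,x_2,\dots\rangle$, where columns that are too short are skipped. **Theorem.** For all $c,k\in\mathbb N$ with $k\ge1$ and $k/4\le c$, and for every 4-wise tuple of order $(c,k)$ over any totally ordered set $X$, the output of $4w\_merge^s_{(c,k)}$ is top $k$ sorted. -/

import Mathlib

namespace MergeNet

/-! Sequences are non-increasing when sorted.  Columns of a tuple are indexed from `0` by `Fin m`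
(so the `i`-th column of the mathematics is index `i - 1`), and likewise the entries of a column. -/

/-- The length `k_i = min (c, ⌊k / i⌋)` of the `i`-th column of a tuple of order `(c, k)`
(the column of index `i : Fin m` is the `(i + 1)`-st one). -/
def colLen (c k : ℕ) {m : ℕ} (i : Fin m) : ℕ := min c (k / (i.val + 1))

/-- The tuple `x` of sequences of lengths `k_1, …, k_m` is `m`-wise of order `(c, k)`. -/
structure IsMWise {α : Type*} [LinearOrder α] (c k : ℕ) {m : ℕ}
    (x : (i : Fin m) → Fin (colLen c k i) → α) : Prop where
  one_le : 1 ≤ k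
  /-- This is `k / m ≤ c` as an inequality of rational numbers. -/
  le_mul : k ≤ m * c
  sorted : ∀ i, Antitone (x i)
  rows : ∀ i i' : Fin m, i'.val = i.val + 1 →
    ∀ (j : ℕ) (hj : j < colLen c k i) (hj' : j < colLen c k i'), x i ⟨j, hj⟩ ≥ x i' ⟨j, hj'⟩

/-- A sequence is top `k` sorted: it has at least `k` entries, the first `k` entries are
non-increasing, and each of them is at least each of the remaining entries. -/
def TopKSorted {α : Type*} [LinearOrder α] (k : ℕ) (l : List α) : Prop :=
  k ≤ l.length ∧ (l.take k).Pairwise (· ≥ ·) ∧ ∀ a ∈ l.take k, ∀ b ∈ l.drop k, a ≥ b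

/-- A `sort^r` operation on the list `ps` of `r` distinct wires: the values on these wires are
rearranged so that they are non-increasing along `ps`; other wires keep their values. -/
def applySorter {ι α : Type*} [DecidableEq ι] [LinearOrder α] (ps : List ι) (f : ι → α) : ι → α :=
  fun p => (((ps.map f).insertionSort (· ≥ ·))[ps.idxOf p]?).getD (f p)

/-- A generalized comparator network is a list of sorters, performed from left to right. -/
def runNetwork {ι α : Type*} [DecidableEq ι] [LinearOrder α] (N : List (List ι)) (f : ι → α) :
    ι → α :=
  N.foldl (fun g ps => applySorter ps g) f

/-- The places of a tuple of columns of lengths `n i`. -/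
abbrev Wire {m : ℕ} (n : Fin m → ℕ) : Type := (i : Fin m) × Fin (n i)

/-- Turns a list of pairs (column, row), with rows numbered from `1`, into a list of places.
A pair that names no entry of the tuple is left out. -/
def toWires {m : ℕ} (n : Fin m → ℕ) (l : List (Fin m × ℕ)) : List (Wire n) :=
  l.filterMap fun p =>
    if h : 1 ≤ p.2 ∧ p.2 ≤ n p.1 then some ⟨p.1, ⟨p.2 - 1, by omega⟩⟩ else none

/-- The entry `w_j` (first column). -/
abbrev wC (j : ℕ) : Fin 4 × ℕ := (0, j)
/-- The entry `x_j` (second column). -/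
abbrev xC (j : ℕ) : Fin 4 × ℕ := (1, j)
/-- The entry `y_j` (third column). -/
abbrev yC (j : ℕ) : Fin 4 × ℕ := (2, j)
/-- The entry `z_j` (fourth column). -/
abbrev zC (j : ℕ) : Fin 4 × ℕ := (3, j)

/-- The sorters of one iteration of the slope-sorting loop, with step `h = h_i`.
Here `List.range' 1 N` is the list `1, …, N`. -/
def slopeStage (k₁ k₂ k₃ k₄ h : ℕ) : List (List (Fin 4 × ℕ)) :=
  ((List.range' 1 (min (k₃ - h) k₄)).map fun j =>
    if j + 3 * h ≤ k₁ ∧ j + 2 * h ≤ k₂ then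
      [zC j, yC (j + h), xC (j + 2 * h), wC (j + 3 * h)]
    else if j + 2 * h ≤ k₂ then
      [zC j, yC (j + h), xC (j + 2 * h)]
    else
      [zC j, yC (j + h)]) ++
  ((List.range' 1 (min (k₂ - h) (min k₃ h))).map fun j =>
    if j + 2 * h ≤ k₁ then
      [yC j, xC (j + h), wC (j + 2 * h)]
    else
      [yC j, xC (j + h)]) ++
  ((List.range' 1 (min (k₁ - h) (min k₂ h))).map fun j => [xC j, wC (j + h)])

/-- The slope-sorting loop started with `h_0 = 2 ^ d`: the iterations have steps
`2 ^ (d - 1), 2 ^ (d - 2), …, 1`. -/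
def slopePhase (k₁ k₂ k₃ k₄ : ℕ) : ℕ → List (List (Fin 4 × ℕ))
  | 0 => []
  | d + 1 => slopeStage k₁ k₂ k₃ k₄ (2 ^ d) ++ slopePhase k₁ k₂ k₃ k₄ d

/-- The sorters of the correction stages.  The test of the last one, `k₁ > k₄ + 1`, says that the
entry `w_{k₄ + 2}` exists. -/
def correctionPhase (k₁ k₂ k₄ k : ℕ) : List (List (Fin 4 × ℕ)) :=
  ((List.range' 1 (min (k₁ - 2) k₄)).map fun j => [zC j, wC (j + 2)]) ++
  ((List.range' 1 (min (k₂ - 1) k₄)).map fun j => [yC j, zC j, wC (j + 1), xC (j + 1)]) ++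
  (if k₁ > k₄ ∧ k₂ = k₄ then [[yC k₄, zC k₄, wC (k₄ + 1)]] else []) ++
  (if k % 4 = 3 ∧ k₁ > k₄ + 1 then [[yC (k₄ + 1), wC (k₄ + 2)]] else [])

/-- All sorters of the 4-Wise Merging Network on columns of lengths `n 0, …, n 3`.
`Nat.clog 2 (n 0)` is the least `l` with `2 ^ l ≥ n 0`. -/
def fourWiseNetwork (n : Fin 4 → ℕ) (k : ℕ) : List (List (Wire n)) :=
  (slopePhase (n 0) (n 1) (n 2) (n 3) (Nat.clog 2 (n 0)) ++
    correctionPhase (n 0) (n 1) (n 3) k).map (toWires n)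

/-- The zip of columns of non-increasing lengths: their entries in row-major order
(a row consists of the entries of those columns that are long enough). -/
def zipCols {α : Type*} (cols : List (List α)) : List α :=
  (List.range (cols.headD []).length).flatMap fun j => cols.filterMap fun col => col[j]?

/-- The output of the 4-Wise Merging Network of order `(c, k)`. -/
def fourWiseMerge {α : Type*} [LinearOrder α] (c k : ℕ)
    (x : (i : Fin 4) → Fin (colLen c k i) → α) : List α :=
  let out : Wire (fun i : Fin 4 => colLen c k i) → α :=
    runNetwork (fourWiseNetwork (fun i => colLen c k i) k) fun p => x p.1 p.2
  zipCols ((List.finRange 4).map fun i => List.ofFn fun j => out ⟨i, j⟩)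

end MergeNet

namespace MergeNet

/-! ### Zero-one principle and general facts about networks of sorters. -/

section Generic

variable {ι κ α β : Type*} [DecidableEq ι] [DecidableEq κ] [LinearOrder α] [LinearOrder β]

/-! Sorters commute with monotone maps, so everything reduces to zero-one inputs. If an output entry
`q` exceeded an earlier entry `p` among the first `k` row-major positions, thresholding at the value
of `q` would give a zero-one tuple with non-increasing column counts `a₁, …, a₄`, whose output is
one at `q` and zero at `p`. If there are at most `k` ones, this contradicts the zero-one statement
that the network then sorts completely in row-major order. If there are more, drop ones until
exactly `k` remain, still as a diagram; the smaller input yields a one at `p`, hence so does the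
larger one, since networks are monotone.

For the zero-one statement (`runNetwork_fourWiseNetwork`), a state is just four column counts.
Suppose adjacent counts differ by at most `2 * h`. Then neighbours in `a₁, a₂ + h, a₃ + 2 * h, a₄ +
3 * h` differ by at most `h`, and so do neighbours after sorting these numbers. The slope sorters
with step `h` perform this sort on the counts, with the largest number going to `z`. Undoing the
shifts exchanges the two bounds: sortedness becomes "gap at most `h`", and gap at most `h` becomes
"columns non-increasing". Sorters missing at the borders do no harm: rows below `1` act as ones, and
rows past a column's end act as zeros, because a one there would force more than `k` ones. Halving
the step brings all gaps down to `1`.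

Then `a₁ ≤ a₄ + 3`. The first correction reduces this to `a₁ ≤ a₄ + 2`, and sorting across two
adjacent rows finishes, except for counts `(m + 2, m + 1, m, m)` with `k = 4 * m + 3`, where
`z_{m+1}` does not exist and the last sorter is needed. -/

theorem idxOf_map_of_injective {e : ι → κ} (he : Function.Injective e) (p : ι) (l : List ι) :
    (l.map e).idxOf (e p) = l.idxOf p := by
  induction l with
  | nil => rfl
  | cons a l ih =>
    by_cases h : a = p
    · simp [h]
    · rw [List.map_cons, List.idxOf_cons_ne _ (fun h' => h (he h')), List.idxOf_cons_ne _ h, ih]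

theorem insertionSort_map_of_monotone {g : α → β} (hg : Monotone g) (l : List α) :
    (l.map g).insertionSort (· ≥ ·) = (l.insertionSort (· ≥ ·)).map g := by
  refine List.Perm.eq_of_pairwise' (r := (· ≥ ·)) (List.pairwise_insertionSort _ _) ?_ ?_
  · exact List.Pairwise.map g (fun a b h => hg h) (List.pairwise_insertionSort _ _)
  · exact (List.perm_insertionSort _ _).trans ((List.perm_insertionSort _ _).symm.map g)

/-- Sorters commute with monotone maps of the values. -/
theorem applySorter_monotone_comp {g : α → β} (hg : Monotone g) (ps : List ι) (f : ι → α) :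
    applySorter ps (g ∘ f) = g ∘ applySorter ps f := by
  funext p
  have : ps.map (g ∘ f) = (ps.map f).map g := by simp
  simp only [applySorter, Function.comp_apply, this, insertionSort_map_of_monotone hg,
    List.getElem?_map]
  cases ((ps.map f).insertionSort (· ≥ ·))[ps.idxOf p]? <;> rfl

theorem runNetwork_monotone_comp {g : α → β} (hg : Monotone g) (N : List (List ι)) (f : ι → α) :
    runNetwork N (g ∘ f) = g ∘ runNetwork N f := by
  induction N generalizing f with
  | nil => rfl
  | cons ps N ih =>
    change runNetwork N (applySorter ps (g ∘ f)) = g ∘ runNetwork N (applySorter ps f)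
    rw [applySorter_monotone_comp hg, ih]

/-- Networks are monotone on Boolean inputs. -/
theorem runNetwork_bool_mono (N : List (List ι)) {u v : ι → Bool} (h : ∀ p, u p = true → v p = true)
    (p : ι) (hp : runNetwork N u p = true) : runNetwork N v p = true := by
  -- For `u ≤ v` both inputs are thresholds, at 2 and at 1, of the single input `u + v`, so the
  -- outputs are thresholds of one output.
  let F : ι → ℕ := fun p => (u p).toNat + (v p).toNat
  have h1 : Monotone (fun m : ℕ => decide (1 ≤ m)) := by
    intro a b hab hd
    simp only [decide_eq_true_eq] at hd ⊢
    omega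
  have h2 : Monotone (fun m : ℕ => decide (2 ≤ m)) := by
    intro a b hab hd
    simp only [decide_eq_true_eq] at hd ⊢
    omega
  have hu : u = (fun m : ℕ => decide (2 ≤ m)) ∘ F := by
    funext q
    have := h q
    simp only [Function.comp_apply, F]
    revert this
    cases u q <;> cases v q <;> decide
  have hv : v = (fun m : ℕ => decide (1 ≤ m)) ∘ F := by
    funext q
    have := h q
    simp only [Function.comp_apply, F]
    revert this
    cases u q <;> cases v q <;> decide
  rw [hu, runNetwork_monotone_comp h2] at hp
  rw [hv, runNetwork_monotone_comp h1]
  simp only [Function.comp_apply, decide_eq_true_eq] at hp ⊢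
  omega

/-- Renaming the wires of a sorter. -/
theorem applySorter_map {e : ι → κ} (he : Function.Injective e) (ps : List ι) (F : κ → α) :
    applySorter (ps.map e) F ∘ e = applySorter ps (F ∘ e) := by
  funext p
  simp [applySorter, idxOf_map_of_injective he]

/-- Renaming the wires of a network. -/
theorem runNetwork_map {e : ι → κ} (he : Function.Injective e) (N : List (List ι)) (F : κ → α) :
    runNetwork (N.map (List.map e)) F ∘ e = runNetwork N (F ∘ e) := by
  induction N generalizing F with
  | nil => rfl
  | cons ps N ih =>
    change runNetwork (N.map (List.map e)) (applySorter (ps.map e) F) ∘ e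
      = runNetwork N (applySorter ps (F ∘ e))
    rw [ih, applySorter_map he]

theorem runNetwork_append (M N : List (List ι)) (f : ι → α) :
    runNetwork (M ++ N) f = runNetwork N (runNetwork M f) := by
  simp [runNetwork]

theorem applySorter_of_not_mem {ps : List ι} {p : ι} (h : p ∉ ps) (f : ι → α) :
    applySorter ps f p = f p := by
  have : ps.idxOf p = ps.length := List.idxOf_eq_length h
  simp [applySorter, this]

theorem applySorter_congr {ps : List ι} {f g : ι → α} (h : ∀ p ∈ ps, f p = g p) {p : ι}
    (hp : p ∈ ps) : applySorter ps f p = applySorter ps g p := by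
  simp only [applySorter, List.map_congr_left h, h p hp]

/-- The effect of a network of sorters on pairwise disjoint sets of wires. -/
theorem runNetwork_eq_of_disjoint {N : List (List ι)} {f g : ι → α}
    (hN : N.Pairwise List.Disjoint)
    (h₁ : ∀ ps ∈ N, ∀ p ∈ ps, applySorter ps f p = g p)
    (h₂ : ∀ p, (∀ ps ∈ N, p ∉ ps) → f p = g p) : runNetwork N f = g := by
  induction N generalizing f with
  | nil => exact funext fun p => h₂ p (by simp)
  | cons ps N ih =>
    change runNetwork N (applySorter ps f) = g
    rw [List.pairwise_cons] at hN
    refine ih hN.2 (fun qs hqs q hq => ?_) (fun p hp => ?_)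
    · rw [← h₁ qs (List.mem_cons_of_mem _ hqs) q hq]
      refine applySorter_congr (fun r hr => applySorter_of_not_mem (fun hr' => ?_) f) hq
      exact hN.1 qs hqs hr' hr
    · by_cases hps : p ∈ ps
      · exact h₁ ps List.mem_cons_self p hps
      · rw [applySorter_of_not_mem hps]
        exact h₂ p (by simpa [hps] using hp)

/-- A sorter moves the ones of a Boolean input to the front. -/
theorem applySorter_bool {ps : List ι} {p : ι} (hp : p ∈ ps) (f : ι → Bool) :
    applySorter ps f p = decide (ps.idxOf p < ps.countP f) := by
  have key : (ps.map f).insertionSort (· ≥ ·) =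
      List.replicate (ps.countP f) true ++ List.replicate (ps.length - ps.countP f) false := by
    refine List.Perm.eq_of_pairwise' (r := (· ≥ ·)) (List.pairwise_insertionSort _ _) ?_ ?_
    · simp [List.pairwise_append, List.pairwise_replicate]
    · refine (List.perm_insertionSort _ _).trans ?_
      clear hp
      induction ps with
      | nil => simp
      | cons q qs ih =>
        have hle := List.countP_le_length (p := f) (l := qs)
        cases hq : f q
        · rw [List.countP_cons_of_neg (by simp [hq])]
          have : (q :: qs).length - qs.countP f = (qs.length - qs.countP f) + 1 := by
            simp; omega
          rw [this, List.replicate_succ, List.map_cons, hq]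
          exact (ih.cons false).trans List.perm_middle.symm
        · rw [List.countP_cons_of_pos (by simp [hq]), List.replicate_succ, List.map_cons, hq]
          simpa using ih
  have hi : ps.idxOf p < ps.length := List.idxOf_lt_length_of_mem hp
  have hle := List.countP_le_length (p := f) (l := ps)
  simp only [applySorter, key]
  by_cases h : ps.idxOf p < ps.countP f
  · rw [List.getElem?_append_left (by simpa using h)]
    simp [h]
  · rw [List.getElem?_append_right (by simpa using h)]
    have : ps.idxOf p - ps.countP f < ps.length - ps.countP f := by omega
    simp [h, this]

end Generic

/-! ### Embedding the tuple into the unbounded grid. -/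

/-- The position of a wire, with rows numbered from `1`. -/
def place {m : ℕ} (n : Fin m → ℕ) (p : Wire n) : Fin m × ℕ := (p.1, p.2.val + 1)

theorem place_injective {m : ℕ} (n : Fin m → ℕ) : Function.Injective (place n) := by
  rintro ⟨i, j, hj⟩ ⟨i', j', hj'⟩ h
  simp only [place, Prod.mk.injEq, Nat.add_right_cancel_iff] at h
  obtain ⟨rfl, rfl⟩ := h
  rfl

/-- Leaving out missing places becomes filtering on the grid, so the network can be studied on `Fin
4 × ℕ` without dependent indices. -/
theorem map_place_toWires {m : ℕ} (n : Fin m → ℕ) (l : List (Fin m × ℕ)) :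
    (toWires n l).map (place n) = l.filter fun p => 1 ≤ p.2 ∧ p.2 ≤ n p.1 := by
  induction l with
  | nil => rfl
  | cons p l ih =>
    by_cases h : 1 ≤ p.2 ∧ p.2 ≤ n p.1
    · have : place n ⟨p.1, ⟨p.2 - 1, by omega⟩⟩ = p := by
        simp only [place]
        ext <;> simp
        omega
      rw [List.filter_cons_of_pos (by simpa using h), ← ih]
      simp only [toWires, List.filterMap_cons, dif_pos h, List.map_cons, this]
    · rw [List.filter_cons_of_neg (by simpa using h), ← ih]
      simp only [toWires, List.filterMap_cons, dif_neg h]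

/-! ### Sorting column counts, and small sorters on zero-one values. -/

/-- Sorting four numbers, each of which differs from its neighbours by at most `h`. -/
theorem exists_sorted_four {A B C D h : ℕ} (hB : h ≤ B) (hC : 2 * h ≤ C) (hD : 3 * h ≤ D)
    (hAB : A ≤ B + h) (hBA : B ≤ A + h) (hBC : B ≤ C + h) (hCB : C ≤ B + h) (hCD : C ≤ D + h)
    (hDC : D ≤ C + h) :
    ∃ s₁ s₂ s₃ s₄ : ℕ, (s₂ ≤ s₁ ∧ s₃ ≤ s₂ ∧ s₄ ≤ s₃) ∧ s₁ + s₂ + s₃ + s₄ = A + B + C + D ∧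
      (s₁ ≤ s₂ + h ∧ s₂ ≤ s₃ + h ∧ s₃ ≤ s₄ + h) ∧ (s₄ ≤ A ∧ h ≤ s₃ ∧ 2 * h ≤ s₂ ∧ 3 * h ≤ s₁) ∧
      ∀ t, (t ≤ s₁ ↔ t ≤ A ∨ t ≤ B ∨ t ≤ C ∨ t ≤ D) ∧
        (t ≤ s₂ ↔ ((t ≤ A ∨ t ≤ B) ∧ (t ≤ C ∨ t ≤ D)) ∨ (t ≤ A ∧ t ≤ B) ∨ (t ≤ C ∧ t ≤ D)) ∧
        (t ≤ s₃ ↔ ((t ≤ A ∨ t ≤ B) ∧ (t ≤ C ∨ t ≤ D)) ∧ ((t ≤ A ∧ t ≤ B) ∨ (t ≤ C ∧ t ≤ D))) ∧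
        (t ≤ s₄ ↔ t ≤ A ∧ t ≤ B ∧ t ≤ C ∧ t ≤ D) := by
  -- The min-max form turns each condition `t ≤ sᵢ` into a Boolean formula in `t ≤ A, …, t ≤ D`, the
  -- shape used in `applySorter_four`.
  refine ⟨max (max A B) (max C D), max (min (max A B) (max C D)) (max (min A B) (min C D)),
    min (min (max A B) (max C D)) (max (min A B) (min C D)), min (min A B) (min C D),
    ?_, ?_, ?_, ?_, fun t => ?_⟩
  · rcases le_total A B with h₁ | h₁ <;> rcases le_total C D with h₂ | h₂ <;>
      simp only [h₁, h₂, max_eq_left, max_eq_right, min_eq_left, min_eq_right] <;> omega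
  · rcases le_total A B with h₁ | h₁ <;> rcases le_total C D with h₂ | h₂ <;>
      simp only [h₁, h₂, max_eq_left, max_eq_right, min_eq_left, min_eq_right] <;> omega
  · rcases le_total A B with h₁ | h₁ <;> rcases le_total C D with h₂ | h₂ <;>
      simp only [h₁, h₂, max_eq_left, max_eq_right, min_eq_left, min_eq_right] <;> omega
  · rcases le_total A B with h₁ | h₁ <;> rcases le_total C D with h₂ | h₂ <;>
      simp only [h₁, h₂, max_eq_left, max_eq_right, min_eq_left, min_eq_right] <;> omega
  · simp only [le_max_iff, le_min_iff]
    tauto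

/-- The zero-one state in which column `i` starts with `![a₁, a₂, a₃, a₄] i` ones. -/
def columnState (a₁ a₂ a₃ a₄ : ℕ) (p : Fin 4 × ℕ) : Bool := decide (p.2 ≤ ![a₁, a₂, a₃, a₄] p.1)

section SmallSorters

variable {ι : Type*} [DecidableEq ι]

theorem applySorter_bool_getElem {ps : List ι} (hps : ps.Nodup) (f : ι → Bool) {i : ℕ}
    (hi : i < ps.length) : applySorter ps f ps[i] = true ↔ i < ps.countP f := by
  rw [applySorter_bool (List.getElem_mem hi), hps.idxOf_getElem, decide_eq_true_eq]

theorem applySorter_two {p q : ι} {f g : ι → Bool} (hps : [p, q].Nodup)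
    (hp : g p = true ↔ f p = true ∨ f q = true) (hq : g q = true ↔ f p = true ∧ f q = true) :
    ∀ x ∈ [p, q], applySorter [p, q] f x = g x := by
  have h₀ := applySorter_bool_getElem hps f (i := 0) (by simp)
  have h₁ := applySorter_bool_getElem hps f (i := 1) (by simp)
  simp only [List.mem_cons, List.not_mem_nil, or_false]
  rintro x (rfl | rfl) <;> rw [Bool.eq_iff_iff]
  · rw [hp]
    refine h₀.trans ?_
    cases e₁ : f x <;> cases e₂ : f q <;> simp [e₁, e₂]
  · rw [hq]
    refine h₁.trans ?_
    cases e₁ : f p <;> cases e₂ : f x <;> simp [e₁, e₂]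

theorem applySorter_three {p q r : ι} {f g : ι → Bool} (hps : [p, q, r].Nodup)
    (hp : g p = true ↔ f p = true ∨ f q = true ∨ f r = true)
    (hq : g q = true ↔ (f p = true ∧ f q = true) ∨ (f r = true ∧ (f p = true ∨ f q = true)))
    (hr : g r = true ↔ f p = true ∧ f q = true ∧ f r = true) :
    ∀ x ∈ [p, q, r], applySorter [p, q, r] f x = g x := by
  have h₀ := applySorter_bool_getElem hps f (i := 0) (by simp)
  have h₁ := applySorter_bool_getElem hps f (i := 1) (by simp)
  have h₂ := applySorter_bool_getElem hps f (i := 2) (by simp)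
  simp only [List.mem_cons, List.not_mem_nil, or_false]
  rintro x (rfl | rfl | rfl) <;> rw [Bool.eq_iff_iff]
  · rw [hp]
    refine h₀.trans ?_
    cases e₁ : f x <;> cases e₂ : f q <;> cases e₃ : f r <;> simp [e₁, e₂, e₃]
  · rw [hq]
    refine h₁.trans ?_
    cases e₁ : f p <;> cases e₂ : f x <;> cases e₃ : f r <;> simp [e₁, e₂, e₃]
  · rw [hr]
    refine h₂.trans ?_
    cases e₁ : f p <;> cases e₂ : f q <;> cases e₃ : f x <;> simp [e₁, e₂, e₃]

theorem applySorter_four {p q r s : ι} {f g : ι → Bool} (hps : [p, q, r, s].Nodup)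
    (hp : g p = true ↔ f s = true ∨ f r = true ∨ f q = true ∨ f p = true)
    (hq : g q = true ↔ ((f s = true ∨ f r = true) ∧ (f q = true ∨ f p = true)) ∨
      (f s = true ∧ f r = true) ∨ (f q = true ∧ f p = true))
    (hr : g r = true ↔ ((f s = true ∨ f r = true) ∧ (f q = true ∨ f p = true)) ∧
      ((f s = true ∧ f r = true) ∨ (f q = true ∧ f p = true)))
    (hs : g s = true ↔ f s = true ∧ f r = true ∧ f q = true ∧ f p = true) :
    ∀ x ∈ [p, q, r, s], applySorter [p, q, r, s] f x = g x := by
  have h₀ := applySorter_bool_getElem hps f (i := 0) (by simp)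
  have h₁ := applySorter_bool_getElem hps f (i := 1) (by simp)
  have h₂ := applySorter_bool_getElem hps f (i := 2) (by simp)
  have h₃ := applySorter_bool_getElem hps f (i := 3) (by simp)
  simp only [List.mem_cons, List.not_mem_nil, or_false]
  rintro x (rfl | rfl | rfl | rfl) <;> rw [Bool.eq_iff_iff]
  · rw [hp]
    refine h₀.trans ?_
    cases e₁ : f x <;> cases e₂ : f q <;> cases e₃ : f r <;> cases e₄ : f s <;>
      simp [e₁, e₂, e₃, e₄]
  · rw [hq]
    refine h₁.trans ?_
    cases e₁ : f p <;> cases e₂ : f x <;> cases e₃ : f r <;> cases e₄ : f s <;>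
      simp [e₁, e₂, e₃, e₄]
  · rw [hr]
    refine h₂.trans ?_
    cases e₁ : f p <;> cases e₂ : f q <;> cases e₃ : f x <;> cases e₄ : f s <;>
      simp [e₁, e₂, e₃, e₄]
  · rw [hs]
    refine h₃.trans ?_
    cases e₁ : f p <;> cases e₂ : f q <;> cases e₃ : f r <;> cases e₄ : f x <;>
      simp [e₁, e₂, e₃, e₄]

end SmallSorters

@[simp]
theorem columnState_zero {a₁ a₂ a₃ a₄ j : ℕ} :
    columnState a₁ a₂ a₃ a₄ (0, j) = true ↔ j ≤ a₁ := decide_eq_true_iff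

@[simp]
theorem columnState_one {a₁ a₂ a₃ a₄ j : ℕ} :
    columnState a₁ a₂ a₃ a₄ (1, j) = true ↔ j ≤ a₂ := decide_eq_true_iff

@[simp]
theorem columnState_two {a₁ a₂ a₃ a₄ j : ℕ} :
    columnState a₁ a₂ a₃ a₄ (2, j) = true ↔ j ≤ a₃ := decide_eq_true_iff

@[simp]
theorem columnState_three {a₁ a₂ a₃ a₄ j : ℕ} :
    columnState a₁ a₂ a₃ a₄ (3, j) = true ↔ j ≤ a₄ := decide_eq_true_iff

/-! ### Slope sorting. -/

/-- The numbers of ones in the columns of a zero-one tuple with at most `k` ones, whose adjacent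
columns differ by at most `h`. -/
structure Balanced (c k h a₁ a₂ a₃ a₄ : ℕ) : Prop where
  le₂ : a₂ ≤ a₁
  le₃ : a₃ ≤ a₂
  le₄ : a₄ ≤ a₃
  le_c : a₁ ≤ c
  sum_le : a₁ + a₂ + a₃ + a₄ ≤ k
  gap₂ : a₁ ≤ a₂ + h
  gap₃ : a₂ ≤ a₃ + h
  gap₄ : a₃ ≤ a₄ + h

theorem pairwise_map_range' {β : Type*} {R : β → β → Prop} {S : ℕ → β} {n : ℕ}
    (h : ∀ i j, i < j → R (S i) (S j)) : ((List.range' 1 n).map S).Pairwise R :=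
  (List.pairwise_lt_range' (s := 1) (n := n)).map S fun i j hij => h i j hij

theorem pairwise_disjoint_slopeStage (k₁ k₂ k₃ k₄ h : ℕ) :
    (slopeStage k₁ k₂ k₃ k₄ h).Pairwise List.Disjoint := by
  unfold slopeStage
  refine List.pairwise_append.2 ⟨List.pairwise_append.2
    ⟨pairwise_map_range' fun i j hij => ?_, pairwise_map_range' fun i j hij => ?_, ?_⟩,
    pairwise_map_range' fun i j hij => ?_, ?_⟩
  · split_ifs <;> simp [List.disjoint_left] <;> omega
  · split_ifs <;> simp [List.disjoint_left] <;> omega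
  · simp only [List.mem_map, List.mem_range'_1]
    rintro _ ⟨i, hi, rfl⟩ _ ⟨j, hj, rfl⟩
    split_ifs <;> simp [List.disjoint_left] <;> omega
  · simp [List.disjoint_left]
    omega
  · simp only [List.mem_append, List.mem_map, List.mem_range'_1]
    rintro _ (⟨i, hi, rfl⟩ | ⟨i, hi, rfl⟩) _ ⟨j, hj, rfl⟩ <;>
    split_ifs <;> simp [List.disjoint_left] <;> omega

theorem forall_not_mem_slopeStage {k₁ k₂ k₃ k₄ h : ℕ} {p : Fin 4 × ℕ}
    (hp : ∀ ps ∈ slopeStage k₁ k₂ k₃ k₄ h, p ∉ ps) :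
    (∀ j, 1 ≤ j → j ≤ k₄ → j + h ≤ k₃ → p ≠ zC j ∧ p ≠ yC (j + h) ∧
      (j + 2 * h ≤ k₂ → p ≠ xC (j + 2 * h) ∧ (j + 3 * h ≤ k₁ → p ≠ wC (j + 3 * h)))) ∧
    (∀ j, 1 ≤ j → j ≤ h → j ≤ k₃ → j + h ≤ k₂ → p ≠ yC j ∧ p ≠ xC (j + h) ∧
      (j + 2 * h ≤ k₁ → p ≠ wC (j + 2 * h))) ∧
    (∀ j, 1 ≤ j → j ≤ h → j ≤ k₂ → j + h ≤ k₁ → p ≠ xC j ∧ p ≠ wC (j + h)) := by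
  simp only [slopeStage, List.mem_append, List.mem_map, List.mem_range'_1] at hp
  refine ⟨fun j h₁ h₂ h₃ => ?_, fun j h₁ h₂ h₃ h₄ => ?_, fun j h₁ h₂ h₃ h₄ => ?_⟩
  · have := hp _ (Or.inl (Or.inl ⟨j, by omega, rfl⟩))
    split_ifs at this with c₁ c₂ <;>
      simp only [List.mem_cons, List.not_mem_nil, or_false, not_or] at this <;> tauto
  · have := hp _ (Or.inl (Or.inr ⟨j, by omega, rfl⟩))
    split_ifs at this with c₁ <;>
      simp only [List.mem_cons, List.not_mem_nil, or_false, not_or] at this <;> tauto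
  · have := hp _ (Or.inr ⟨j, by omega, rfl⟩)
    simpa only [List.mem_cons, List.not_mem_nil, or_false, not_or] using this

/-- The effect of slope sorting with step `h` on the numbers of ones in the columns: the numbers
`b₄ + 3 * h, b₃ + 2 * h, b₂ + h, b₁` are obtained by sorting `a₁, a₂ + h, a₃ + 2 * h, a₄ + 3 * h`. -/
structure SlopeStep (c k h a₁ a₂ a₃ a₄ b₁ b₂ b₃ b₄ : ℕ) : Prop where
  balanced : Balanced c k (2 * h) a₁ a₂ a₃ a₄
  le_mul : k ≤ 4 * c
  z_iff : ∀ j, j ≤ b₄ ↔ j + 3 * h ≤ a₁ ∨ j + 2 * h ≤ a₂ ∨ j + h ≤ a₃ ∨ j ≤ a₄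
  y_iff : ∀ j, j ≤ b₃ ↔ ((j + 2 * h ≤ a₁ ∨ j + h ≤ a₂) ∧ (j ≤ a₃ ∨ j ≤ a₄ + h)) ∨
    (j + 2 * h ≤ a₁ ∧ j + h ≤ a₂) ∨ (j ≤ a₃ ∧ j ≤ a₄ + h)
  x_iff : ∀ j, j ≤ b₂ ↔ ((j + h ≤ a₁ ∨ j ≤ a₂) ∧ (j ≤ a₃ + h ∨ j ≤ a₄ + 2 * h)) ∧
    ((j + h ≤ a₁ ∧ j ≤ a₂) ∨ (j ≤ a₃ + h ∧ j ≤ a₄ + 2 * h))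
  w_iff : ∀ j, j ≤ b₁ ↔ j ≤ a₁ ∧ j ≤ a₂ + h ∧ j ≤ a₃ + 2 * h ∧ j ≤ a₄ + 3 * h

/-- Halving the gaps: the shifts make consecutive numbers differ by at most `h`, a property that
survives sorting. -/
theorem Balanced.exists_slopeStep {c k h a₁ a₂ a₃ a₄ : ℕ} (hk : k ≤ 4 * c)
    (H : Balanced c k (2 * h) a₁ a₂ a₃ a₄) :
    ∃ b₁ b₂ b₃ b₄, SlopeStep c k h a₁ a₂ a₃ a₄ b₁ b₂ b₃ b₄ ∧ Balanced c k h b₁ b₂ b₃ b₄ ∧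
      b₁ + b₂ + b₃ + b₄ = a₁ + a₂ + a₃ + a₄ := by
  obtain ⟨le₂, le₃, le₄, le_c, sum_le, gap₂, gap₃, gap₄⟩ := id H
  obtain ⟨s₁, s₂, s₃, s₄, ⟨h₁₂, h₂₃, h₃₄⟩, hs, ⟨g₁₂, g₂₃, g₃₄⟩, ⟨l₄, l₃, l₂, l₁⟩, spec⟩ :=
    exists_sorted_four (A := a₁) (B := a₂ + h) (C := a₃ + 2 * h) (D := a₄ + 3 * h) (h := h)
      (by omega) (by omega) (by omega) (by omega) (by omega) (by omega) (by omega) (by omega)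
      (by omega)
  -- The lower bounds on the order statistics allow the shifts to be removed; the order is reversed,
  -- so the smallest number becomes the new count of `w`.
  obtain ⟨b₂, rfl⟩ := Nat.exists_eq_add_of_le' l₃
  obtain ⟨b₃, rfl⟩ := Nat.exists_eq_add_of_le' l₂
  obtain ⟨b₄, rfl⟩ := Nat.exists_eq_add_of_le' l₁
  refine ⟨s₄, b₂, b₃, b₄, ⟨H, hk, fun j => ?_, fun j => ?_, fun j => ?_, fun j => ?_⟩, ?_, ?_⟩
  · rw [← Nat.add_le_add_iff_right (n := 3 * h), (spec (j + 3 * h)).1,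
      show j + 3 * h ≤ a₂ + h ↔ j + 2 * h ≤ a₂ by omega,
      show j + 3 * h ≤ a₃ + 2 * h ↔ j + h ≤ a₃ by omega,
      show j + 3 * h ≤ a₄ + 3 * h ↔ j ≤ a₄ by omega]
  · rw [← Nat.add_le_add_iff_right (n := 2 * h), (spec (j + 2 * h)).2.1,
      show j + 2 * h ≤ a₂ + h ↔ j + h ≤ a₂ by omega,
      show j + 2 * h ≤ a₃ + 2 * h ↔ j ≤ a₃ by omega,
      show j + 2 * h ≤ a₄ + 3 * h ↔ j ≤ a₄ + h by omega]
  · rw [← Nat.add_le_add_iff_right (n := h), (spec (j + h)).2.2.1,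
      show j + h ≤ a₂ + h ↔ j ≤ a₂ by omega,
      show j + h ≤ a₃ + 2 * h ↔ j ≤ a₃ + h by omega,
      show j + h ≤ a₄ + 3 * h ↔ j ≤ a₄ + 2 * h by omega]
  · exact (spec j).2.2.2
  · clear spec
    constructor <;> omega
  · clear spec
    omega

namespace SlopeStep

variable {c k h a₁ a₂ a₃ a₄ b₁ b₂ b₃ b₄ j r : ℕ}

theorem applySorter_z (H : SlopeStep c k h a₁ a₂ a₃ a₄ b₁ b₂ b₃ b₄) :
    ∀ p ∈ [zC j, yC (j + h), xC (j + 2 * h), wC (j + 3 * h)],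
      applySorter [zC j, yC (j + h), xC (j + 2 * h), wC (j + 3 * h)]
        (columnState a₁ a₂ a₃ a₄) p = columnState b₁ b₂ b₃ b₄ p := by
  apply applySorter_four (by simp)
  · simpa only [columnState_zero, columnState_one, columnState_two, columnState_three]
      using H.z_iff j
  · simp only [columnState_zero, columnState_one, columnState_two, columnState_three]
    rw [H.y_iff, show j + h + 2 * h = j + 3 * h by omega, show j + h + h = j + 2 * h by omega,
      show j + h ≤ a₄ + h ↔ j ≤ a₄ by omega]
  · simp only [columnState_zero, columnState_one, columnState_two, columnState_three]
    rw [H.x_iff, show j + 2 * h + h = j + 3 * h by omega,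
      show j + 2 * h ≤ a₃ + h ↔ j + h ≤ a₃ by omega,
      show j + 2 * h ≤ a₄ + 2 * h ↔ j ≤ a₄ by omega]
  · simp only [columnState_zero, columnState_one, columnState_two, columnState_three]
    rw [H.w_iff, show j + 3 * h ≤ a₂ + h ↔ j + 2 * h ≤ a₂ by omega,
      show j + 3 * h ≤ a₃ + 2 * h ↔ j + h ≤ a₃ by omega,
      show j + 3 * h ≤ a₄ + 3 * h ↔ j ≤ a₄ by omega]

/-- A missing `w` place counts as a zero at the end of the sorter, so dropping it changes nothing.
-/
theorem applySorter_z_of_w (H : SlopeStep c k h a₁ a₂ a₃ a₄ b₁ b₂ b₃ b₄)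
    (w : ¬ j + 3 * h ≤ a₁) : ∀ p ∈ [zC j, yC (j + h), xC (j + 2 * h)],
      applySorter [zC j, yC (j + h), xC (j + 2 * h)]
        (columnState a₁ a₂ a₃ a₄) p = columnState b₁ b₂ b₃ b₄ p := by
  apply applySorter_three (by simp)
  · simp only [columnState_one, columnState_two, columnState_three]
    rw [H.z_iff]
    tauto
  · simp only [columnState_one, columnState_two, columnState_three]
    rw [H.y_iff, show j + h + 2 * h = j + 3 * h by omega, show j + h + h = j + 2 * h by omega,
      show j + h ≤ a₄ + h ↔ j ≤ a₄ by omega]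
    tauto
  · simp only [columnState_one, columnState_two, columnState_three]
    rw [H.x_iff, show j + 2 * h + h = j + 3 * h by omega,
      show j + 2 * h ≤ a₃ + h ↔ j + h ≤ a₃ by omega,
      show j + 2 * h ≤ a₄ + 2 * h ↔ j ≤ a₄ by omega]
    tauto

theorem applySorter_z_of_w_of_x (H : SlopeStep c k h a₁ a₂ a₃ a₄ b₁ b₂ b₃ b₄)
    (w : ¬ j + 3 * h ≤ a₁) (x : ¬ j + 2 * h ≤ a₂) : ∀ p ∈ [zC j, yC (j + h)],
      applySorter [zC j, yC (j + h)]
        (columnState a₁ a₂ a₃ a₄) p = columnState b₁ b₂ b₃ b₄ p := by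
  apply applySorter_two (by simp)
  · simp only [columnState_two, columnState_three]
    rw [H.z_iff]
    tauto
  · simp only [columnState_two, columnState_three]
    rw [H.y_iff, show j + h + 2 * h = j + 3 * h by omega, show j + h + h = j + 2 * h by omega,
      show j + h ≤ a₄ + h ↔ j ≤ a₄ by omega]
    tauto

/-- For `j ≤ h` the absent place `z_{j-h}` would have a non-positive row and so acts as a one at the
front of the full four-sorter. -/
theorem applySorter_y (H : SlopeStep c k h a₁ a₂ a₃ a₄ b₁ b₂ b₃ b₄) (hj : j ≤ h) :
    ∀ p ∈ [yC j, xC (j + h), wC (j + 2 * h)],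
      applySorter [yC j, xC (j + h), wC (j + 2 * h)]
        (columnState a₁ a₂ a₃ a₄) p = columnState b₁ b₂ b₃ b₄ p := by
  have z₁ : j ≤ a₄ + h := by omega
  have z₂ : j + h ≤ a₄ + 2 * h := by omega
  have z₃ : j + 2 * h ≤ a₄ + 3 * h := by omega
  apply applySorter_three (by simp)
  · simp only [columnState_zero, columnState_one, columnState_two]
    rw [H.y_iff]
    tauto
  · simp only [columnState_zero, columnState_one, columnState_two]
    rw [H.x_iff, show j + h + h = j + 2 * h by omega, show j + h ≤ a₃ + h ↔ j ≤ a₃ by omega]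
    tauto
  · simp only [columnState_zero, columnState_one, columnState_two]
    rw [H.w_iff, show j + 2 * h ≤ a₂ + h ↔ j + h ≤ a₂ by omega,
      show j + 2 * h ≤ a₃ + 2 * h ↔ j ≤ a₃ by omega]
    tauto

theorem applySorter_y_of_w (H : SlopeStep c k h a₁ a₂ a₃ a₄ b₁ b₂ b₃ b₄) (hj : j ≤ h)
    (w : ¬ j + 2 * h ≤ a₁) : ∀ p ∈ [yC j, xC (j + h)],
      applySorter [yC j, xC (j + h)]
        (columnState a₁ a₂ a₃ a₄) p = columnState b₁ b₂ b₃ b₄ p := by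
  have z₁ : j ≤ a₄ + h := by omega
  have z₂ : j + h ≤ a₄ + 2 * h := by omega
  apply applySorter_two (by simp)
  · simp only [columnState_one, columnState_two]
    rw [H.y_iff]
    tauto
  · simp only [columnState_one, columnState_two]
    rw [H.x_iff, show j + h + h = j + 2 * h by omega, show j + h ≤ a₃ + h ↔ j ≤ a₃ by omega]
    tauto

theorem applySorter_x (H : SlopeStep c k h a₁ a₂ a₃ a₄ b₁ b₂ b₃ b₄) (hj : j ≤ h) :
    ∀ p ∈ [xC j, wC (j + h)],
      applySorter [xC j, wC (j + h)]
        (columnState a₁ a₂ a₃ a₄) p = columnState b₁ b₂ b₃ b₄ p := by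
  have y₁ : j ≤ a₃ + h := by omega
  have z₁ : j ≤ a₄ + 2 * h := by omega
  have y₂ : j + h ≤ a₃ + 2 * h := by omega
  have z₂ : j + h ≤ a₄ + 3 * h := by omega
  apply applySorter_two (by simp)
  · simp only [columnState_zero, columnState_one]
    rw [H.x_iff]
    tauto
  · simp only [columnState_zero, columnState_one]
    rw [H.w_iff, show j + h ≤ a₂ + h ↔ j ≤ a₂ by omega]
    tauto

theorem applySorter_slopeStage (H : SlopeStep c k h a₁ a₂ a₃ a₄ b₁ b₂ b₃ b₄) :
    ∀ ps ∈ slopeStage (min c k) (min c (k / 2)) (min c (k / 3)) (min c (k / 4)) h, ∀ p ∈ ps,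
      applySorter ps (columnState a₁ a₂ a₃ a₄) p = columnState b₁ b₂ b₃ b₄ p := by
  obtain ⟨le₂, le₃, le₄, le_c, sum_le, gap₂, gap₃, gap₄⟩ := H.balanced
  intro ps hps
  simp only [slopeStage, List.mem_append, List.mem_map, List.mem_range'_1] at hps
  rcases hps with ((⟨j, hj, rfl⟩ | ⟨j, hj, rfl⟩) | ⟨j, hj, rfl⟩)
  · split_ifs with c₁ c₂
    · exact H.applySorter_z
    · exact H.applySorter_z_of_w (by omega)
    · exact H.applySorter_z_of_w_of_x (by omega) (by omega)
  · split_ifs with c₁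
    · exact H.applySorter_y (by omega)
    · exact H.applySorter_y_of_w (by omega) (by omega)
  · exact H.applySorter_x (by omega)

/-- If sorting the counts changed an untouched place, a place beyond a column's end on the same
slope would be involved; the order and gap bounds would then force more than `k` ones. -/
theorem eq_of_forall_not_mem (H : SlopeStep c k h a₁ a₂ a₃ a₄ b₁ b₂ b₃ b₄) (hh : 1 ≤ h)
    {p : Fin 4 × ℕ} (hp : ∀ ps ∈ slopeStage (min c k) (min c (k / 2)) (min c (k / 3))
      (min c (k / 4)) h, p ∉ ps) :
    columnState a₁ a₂ a₃ a₄ p = columnState b₁ b₂ b₃ b₄ p := by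
  obtain ⟨le₂, le₃, le₄, le_c, sum_le, gap₂, gap₃, gap₄⟩ := H.balanced
  have hk := H.le_mul
  obtain ⟨p₁, p₂, p₃⟩ := forall_not_mem_slopeStage hp
  clear hp
  obtain ⟨i, r⟩ := p
  rw [Bool.eq_iff_iff]
  fin_cases i
  · change columnState a₁ a₂ a₃ a₄ (0, r) = true ↔ columnState b₁ b₂ b₃ b₄ (0, r) = true
    rw [columnState_zero, columnState_zero, H.w_iff]
    have q₁ := fun e₁ e₂ e₃ e₄ => ((p₁ (r - 3 * h) e₁ e₂ e₃).2.2 e₄).2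
    have q₂ := fun e₁ e₂ e₃ e₄ => (p₂ (r - 2 * h) e₁ e₂ e₃ e₄).2.2
    have q₃ := fun e₁ e₂ e₃ e₄ => (p₃ (r - h) e₁ e₂ e₃ e₄).2
    clear p₁ p₂ p₃ H
    simp only [ne_eq, Prod.mk.injEq, Fin.mk_zero, true_and] at q₁ q₂ q₃
    refine ⟨fun hr => ?_, fun hr => hr.1⟩
    by_cases t₁ : r ≤ h
    · omega
    by_cases t₂ : r ≤ 2 * h
    · clear q₁ q₂
      have := fun e => q₃ (by omega) (by omega) e (by omega) (by omega)
      omega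
    by_cases t₃ : r ≤ 3 * h
    · clear q₁ q₃
      have := fun e e' => q₂ (by omega) (by omega) e e' (by omega) (by omega)
      omega
    · clear q₂ q₃
      have := fun e e' e'' => q₁ (by omega) e e' e'' (by omega) (by omega)
      omega
  · change columnState a₁ a₂ a₃ a₄ (1, r) = true ↔ columnState b₁ b₂ b₃ b₄ (1, r) = true
    rw [columnState_one, columnState_one, H.x_iff]
    have q₁ := fun e₁ e₂ e₃ e₄ => ((p₁ (r - 2 * h) e₁ e₂ e₃).2.2 e₄).1
    have q₂ := fun e₁ e₂ e₃ e₄ => (p₂ (r - h) e₁ e₂ e₃ e₄).2.1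
    have q₃ := fun e₁ e₂ e₃ e₄ => (p₃ r e₁ e₂ e₃ e₄).1
    clear p₁ p₂ p₃ H
    simp only [ne_eq, Prod.mk.injEq, Fin.mk_one, true_and, not_true_eq_false] at q₁ q₂ q₃
    -- These implications say that the ones on this slope already precede its zeros around `x_r`, so
    -- the order statistic there is decided by `a₂` alone.
    suffices (r + h ≤ a₁ → r ≤ a₂) ∧ (r ≤ a₂ → r ≤ a₃ + h ∧ r ≤ a₄ + 2 * h) by
      clear q₁ q₂ q₃
      tauto
    by_cases t₀ : r = 0
    · omega
    by_cases t₁ : r ≤ h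
    · clear q₁ q₂
      have : ¬ (r ≤ min c (k / 2) ∧ r + h ≤ min c k) := fun e => q₃ (by omega) (by omega) e.1 e.2
      omega
    by_cases t₂ : r ≤ 2 * h
    · clear q₁ q₃
      have := fun e e' => q₂ (by omega) (by omega) e e' (by omega)
      omega
    · clear q₂ q₃
      have := fun e e' e'' => q₁ (by omega) e e' e'' (by omega)
      omega
  · change columnState a₁ a₂ a₃ a₄ (2, r) = true ↔ columnState b₁ b₂ b₃ b₄ (2, r) = true
    rw [columnState_two, columnState_two, H.y_iff]
    have q₁ := fun e₁ e₂ e₃ => (p₁ (r - h) e₁ e₂ e₃).2.1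
    have q₂ := fun e₁ e₂ e₃ e₄ => (p₂ r e₁ e₂ e₃ e₄).1
    clear p₁ p₂ p₃ H
    simp only [ne_eq, Prod.mk.injEq, Fin.reduceFinMk, true_and, not_true_eq_false] at q₁ q₂
    suffices (r + 2 * h ≤ a₁ → r ≤ a₃) ∧ (r + h ≤ a₂ → r ≤ a₃) ∧ (r ≤ a₃ → r ≤ a₄ + h) by
      clear q₁ q₂
      tauto
    by_cases t₀ : r = 0
    · omega
    by_cases t₁ : r ≤ h
    · clear q₁
      have : ¬ (r ≤ min c (k / 3) ∧ r + h ≤ min c (k / 2)) :=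
        fun e => q₂ (by omega) (by omega) e.1 e.2
      omega
    · clear q₂
      have := fun e e' => q₁ (by omega) e e' (by omega)
      omega
  · change columnState a₁ a₂ a₃ a₄ (3, r) = true ↔ columnState b₁ b₂ b₃ b₄ (3, r) = true
    rw [columnState_three, columnState_three, H.z_iff]
    have q₁ := fun e₁ e₂ e₃ => (p₁ r e₁ e₂ e₃).1
    clear p₁ p₂ p₃ H
    simp only [ne_eq, Fin.reduceFinMk, not_true_eq_false] at q₁
    suffices (r + 3 * h ≤ a₁ → r ≤ a₄) ∧ (r + 2 * h ≤ a₂ → r ≤ a₄) ∧ (r + h ≤ a₃ → r ≤ a₄) by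
      clear q₁
      tauto
    by_cases t₀ : r = 0
    · omega
    · have : ¬ (r ≤ min c (k / 4) ∧ r + h ≤ min c (k / 3)) := fun e => q₁ (by omega) e.1 e.2
      omega

end SlopeStep

theorem runNetwork_slopeStage {c k h a₁ a₂ a₃ a₄ : ℕ} (hh : 1 ≤ h) (hk : k ≤ 4 * c)
    (H : Balanced c k (2 * h) a₁ a₂ a₃ a₄) :
    ∃ b₁ b₂ b₃ b₄, Balanced c k h b₁ b₂ b₃ b₄ ∧ b₁ + b₂ + b₃ + b₄ = a₁ + a₂ + a₃ + a₄ ∧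
      runNetwork (slopeStage (min c k) (min c (k / 2)) (min c (k / 3)) (min c (k / 4)) h)
        (columnState a₁ a₂ a₃ a₄) = columnState b₁ b₂ b₃ b₄ := by
  obtain ⟨b₁, b₂, b₃, b₄, hb, hb', hs⟩ := H.exists_slopeStep hk
  exact ⟨b₁, b₂, b₃, b₄, hb', hs,
    runNetwork_eq_of_disjoint (pairwise_disjoint_slopeStage _ _ _ _ _) hb.applySorter_slopeStage
      fun p hp => hb.eq_of_forall_not_mem hh hp⟩

theorem runNetwork_slopePhase {c k d a₁ a₂ a₃ a₄ : ℕ} (hk : k ≤ 4 * c)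
    (H : Balanced c k (2 ^ d) a₁ a₂ a₃ a₄) :
    ∃ b₁ b₂ b₃ b₄, Balanced c k 1 b₁ b₂ b₃ b₄ ∧ b₁ + b₂ + b₃ + b₄ = a₁ + a₂ + a₃ + a₄ ∧
      runNetwork (slopePhase (min c k) (min c (k / 2)) (min c (k / 3)) (min c (k / 4)) d)
        (columnState a₁ a₂ a₃ a₄) = columnState b₁ b₂ b₃ b₄ := by
  induction d generalizing a₁ a₂ a₃ a₄ with
  | zero => exact ⟨a₁, a₂, a₃, a₄, H, rfl, rfl⟩
  | succ d ih =>
    rw [pow_succ'] at H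
    obtain ⟨b₁, b₂, b₃, b₄, hb, hs, e⟩ := runNetwork_slopeStage Nat.one_le_two_pow hk H
    obtain ⟨b₁', b₂', b₃', b₄', hb', hs', e'⟩ := ih hb
    exact ⟨b₁', b₂', b₃', b₄', hb', hs'.trans hs, by rw [slopePhase, runNetwork_append, e, e']⟩

/-! ### Correction stages and the existence of the sorted places. -/

/-- The values on `z_j` and `w_{j+2}` are exchanged exactly when `a₄ < j ≤ a₁ - 2`. With gaps at
most 1 this happens for at most one `j`, only if `a₁ = a₄ + 3`; then there are `4 * a₄ + 6` ones, so
both places exist. -/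
theorem runNetwork_correction_zw {c k a₁ a₂ a₃ a₄ : ℕ} (hk : k ≤ 4 * c)
    (H : Balanced c k 1 a₁ a₂ a₃ a₄) :
    runNetwork ((List.range' 1 (min (min c k - 2) (min c (k / 4)))).map
      fun j => [zC j, wC (j + 2)]) (columnState a₁ a₂ a₃ a₄) =
      columnState (min a₁ (a₄ + 2)) a₂ a₃ (max a₄ (a₁ - 2)) := by
  obtain ⟨le₂, le₃, le₄, le_c, sum_le, gap₂, gap₃, gap₄⟩ := H
  refine runNetwork_eq_of_disjoint (pairwise_map_range' fun i j hij => ?_) ?_ ?_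
  · simp [List.disjoint_left]
    omega
  · simp only [List.mem_map, List.mem_range'_1]
    rintro _ ⟨j, hj, rfl⟩
    apply applySorter_two (by simp) <;> simp only [columnState_zero, columnState_three] <;> omega
  · rintro ⟨i, r⟩ hp
    simp only [List.mem_map, List.mem_range'_1] at hp
    rw [Bool.eq_iff_iff]
    fin_cases i
    · change columnState _ _ _ _ (0, r) = true ↔ columnState _ _ _ _ (0, r) = true
      rw [columnState_zero, columnState_zero]
      have := fun e => hp _ ⟨r - 2, e, rfl⟩
      simp at this
      omega
    · change columnState _ _ _ _ (1, r) = true ↔ columnState _ _ _ _ (1, r) = true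
      rw [columnState_one, columnState_one]
    · change columnState _ _ _ _ (2, r) = true ↔ columnState _ _ _ _ (2, r) = true
      rw [columnState_two, columnState_two]
    · change columnState _ _ _ _ (3, r) = true ↔ columnState _ _ _ _ (3, r) = true
      rw [columnState_three, columnState_three]
      have : ¬ (1 ≤ r ∧ r < 1 + min (min c k - 2) (min c (k / 4))) :=
        fun e => hp _ ⟨r, e, rfl⟩ List.mem_cons_self
      omega

/-- The possible effects of the sorters of `correctionPhase` that act on two adjacent rows. -/
theorem runNetwork_correction_rows {c k a₁ a₂ a₃ a₄ b₁ b₂ b₃ b₄ : ℕ} (hk : k ≤ 4 * c)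
    (h : (b₁ = a₁ ∧ b₂ = a₂ ∧ b₃ = a₃ ∧ b₄ = a₄ ∧ a₄ ≤ a₃ ∧ a₃ ≤ a₂ ∧ a₂ ≤ a₁ ∧ a₁ ≤ a₄ + 1) ∨
      (b₁ = a₁ ∧ b₂ = a₂ ∧ b₃ = a₃ ∧ b₄ = a₄ ∧ a₁ = a₄ + 2 ∧ a₂ = a₄ + 1 ∧ a₃ = a₄ ∧
        k = 4 * a₄ + 3) ∨
      (4 * a₄ + 4 ≤ k ∧ a₁ ≤ c ∧ a₁ = a₄ + 2 ∧
        (a₂ = a₄ + 1 ∨ a₂ = a₄ + 2) ∧ (a₃ = a₄ ∨ a₃ = a₄ + 1) ∧ a₂ ≤ a₃ + 1 ∧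
        b₁ + b₂ + b₃ + b₄ = a₁ + a₂ + a₃ + a₄ ∧ b₄ ≤ b₃ ∧ b₃ ≤ b₂ ∧ b₂ ≤ b₁ ∧ b₁ ≤ b₄ + 1)) :
    runNetwork ((List.range' 1 (min (min c (k / 2) - 1) (min c (k / 4)))).map
      fun j => [yC j, zC j, wC (j + 1), xC (j + 1)]) (columnState a₁ a₂ a₃ a₄) =
      columnState b₁ b₂ b₃ b₄ := by
  refine runNetwork_eq_of_disjoint (pairwise_map_range' fun i j hij => ?_) ?_ ?_
  · simp [List.disjoint_left]
    omega
  · simp only [List.mem_map, List.mem_range'_1]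
    rintro _ ⟨j, hj, rfl⟩
    apply applySorter_four (by simp) <;>
      simp only [columnState_zero, columnState_one, columnState_two, columnState_three] <;>
      rcases h with h | h | h <;> omega
  · rintro ⟨i, r⟩ hp
    simp only [List.mem_map, List.mem_range'_1] at hp
    rw [Bool.eq_iff_iff]
    have q : ∀ j, (1 ≤ j ∧ j < 1 + min (min c (k / 2) - 1) (min c (k / 4))) →
        (i, r) ≠ yC j ∧ (i, r) ≠ zC j ∧ (i, r) ≠ wC (j + 1) ∧ (i, r) ≠ xC (j + 1) := by
      intro j hj
      simpa only [List.mem_cons, List.not_mem_nil, or_false, not_or] using hp _ ⟨j, hj, rfl⟩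
    clear hp
    fin_cases i
    · change columnState _ _ _ _ (0, r) = true ↔ columnState _ _ _ _ (0, r) = true
      rw [columnState_zero, columnState_zero]
      have : ¬ (1 ≤ r - 1 ∧ r - 1 < 1 + min (min c (k / 2) - 1) (min c (k / 4))) :=
        fun e => (q _ e).2.2.1 (by simp; omega)
      rcases h with h | h | h <;> omega
    · change columnState _ _ _ _ (1, r) = true ↔ columnState _ _ _ _ (1, r) = true
      rw [columnState_one, columnState_one]
      have : ¬ (1 ≤ r - 1 ∧ r - 1 < 1 + min (min c (k / 2) - 1) (min c (k / 4))) :=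
        fun e => (q _ e).2.2.2 (by simp; omega)
      rcases h with h | h | h <;> omega
    · change columnState _ _ _ _ (2, r) = true ↔ columnState _ _ _ _ (2, r) = true
      rw [columnState_two, columnState_two]
      have : ¬ (1 ≤ r ∧ r < 1 + min (min c (k / 2) - 1) (min c (k / 4))) :=
        fun e => (q _ e).1 rfl
      rcases h with h | h | h <;> omega
    · change columnState _ _ _ _ (3, r) = true ↔ columnState _ _ _ _ (3, r) = true
      rw [columnState_three, columnState_three]
      have : ¬ (1 ≤ r ∧ r < 1 + min (min c (k / 2) - 1) (min c (k / 4))) :=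
        fun e => (q _ e).2.1 rfl
      rcases h with h | h | h <;> omega

theorem applySorter_singleton {ι α : Type*} [DecidableEq ι] [LinearOrder α] (p : ι) (f : ι → α) :
    applySorter [p] f = f := by
  funext q
  by_cases h : p = q
  · simp [applySorter, h]
  · simp [applySorter, List.idxOf_cons_ne _ h]

/-- The places of the tuple exist for all sorters of the slope-sorting loop. -/
theorem exists_of_mem_slopeStage {n : Fin 4 → ℕ} {h : ℕ} {ps : List (Fin 4 × ℕ)}
    (hps : ps ∈ slopeStage (n 0) (n 1) (n 2) (n 3) h) : ∀ p ∈ ps, 1 ≤ p.2 ∧ p.2 ≤ n p.1 := by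
  simp only [slopeStage, List.mem_append, List.mem_map, List.mem_range'_1] at hps
  rcases hps with ((⟨j, hj, rfl⟩ | ⟨j, hj, rfl⟩) | ⟨j, hj, rfl⟩)
  · split_ifs <;> simp <;> omega
  · split_ifs <;> simp <;> omega
  · simp
    omega

theorem exists_of_mem_slopePhase {n : Fin 4 → ℕ} {d : ℕ} {ps : List (Fin 4 × ℕ)}
    (hps : ps ∈ slopePhase (n 0) (n 1) (n 2) (n 3) d) : ∀ p ∈ ps, 1 ≤ p.2 ∧ p.2 ≤ n p.1 := by
  induction d with
  | zero => simp [slopePhase] at hps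
  | succ d ih =>
    rw [slopePhase, List.mem_append] at hps
    exact hps.elim exists_of_mem_slopeStage ih

theorem map_filter_eq_self {ι : Type*} {P : ι → Bool} {N : List (List ι)}
    (h : ∀ ps ∈ N, ∀ p ∈ ps, P p = true) : N.map (List.filter P) = N :=
  (List.map_congr_left fun ps hps => List.filter_eq_self.2 (h ps hps)).trans (List.map_id _)

/-- The last correction sorter. -/
theorem runNetwork_correction_yw {c k a₁ a₂ a₃ a₄ b₁ b₂ b₃ b₄ : ℕ}
    (h : (b₁ = a₁ ∧ b₂ = a₂ ∧ b₃ = a₃ ∧ b₄ = a₄ ∧ a₁ + a₂ + a₃ + a₄ ≤ k ∧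
        a₄ ≤ a₃ ∧ a₃ ≤ a₂ ∧ a₂ ≤ a₁ ∧ a₁ ≤ a₄ + 1 ∧ a₁ ≤ c) ∨
      (b₁ = a₄ + 1 ∧ b₂ = a₂ ∧ b₃ = a₄ + 1 ∧ b₄ = a₄ ∧ a₁ = a₄ + 2 ∧ a₃ = a₄ ∧
        k = 4 * a₄ + 3 ∧ a₁ ≤ c)) :
    runNetwork (if k % 4 = 3 ∧ min c k > min c (k / 4) + 1 then
      [[yC (min c (k / 4) + 1), wC (min c (k / 4) + 2)]] else [])
      (columnState a₁ a₂ a₃ a₄) = columnState b₁ b₂ b₃ b₄ := by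
  split_ifs with hc
  · refine runNetwork_eq_of_disjoint (List.pairwise_singleton _ _) ?_ ?_
    · simp only [List.mem_singleton]
      rintro _ rfl
      apply applySorter_two (by simp) <;> simp only [columnState_zero, columnState_two] <;>
        rcases h with h | h <;> omega
    · rintro ⟨i, r⟩ hp
      simp only [forall_eq, List.mem_cons, List.not_mem_nil, or_false,
        not_or] at hp
      rw [Bool.eq_iff_iff]
      fin_cases i
      · change columnState _ _ _ _ (0, r) = true ↔ columnState _ _ _ _ (0, r) = true
        rw [columnState_zero, columnState_zero]
        have : r ≠ min c (k / 4) + 2 := fun e => hp.2 (by simp [e])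
        rcases h with h | h <;> omega
      · change columnState _ _ _ _ (1, r) = true ↔ columnState _ _ _ _ (1, r) = true
        rw [columnState_one, columnState_one]
        rcases h with h | h <;> omega
      · change columnState _ _ _ _ (2, r) = true ↔ columnState _ _ _ _ (2, r) = true
        rw [columnState_two, columnState_two]
        have : r ≠ min c (k / 4) + 1 := fun e => hp.1 (by simp [e])
        rcases h with h | h <;> omega
      · change columnState _ _ _ _ (3, r) = true ↔ columnState _ _ _ _ (3, r) = true
        rw [columnState_three, columnState_three]
        rcases h with h | h <;> omega
  · change columnState a₁ a₂ a₃ a₄ = columnState b₁ b₂ b₃ b₄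
    rw [show b₁ = a₁ by omega, show b₂ = a₂ by omega, show b₃ = a₃ by omega,
      show b₄ = a₄ by omega]

/-- The third correction sorter acts on at most one existing place. -/
theorem runNetwork_correction_yzw {α : Type*} [LinearOrder α] {n : Fin 4 → ℕ} {c k : ℕ}
    (n₀ : n 0 = min c k) (n₁ : n 1 = min c (k / 2)) (n₃ : n 3 = min c (k / 4))
    (f : Fin 4 × ℕ → α) :
    runNetwork ((if n 0 > n 3 ∧ n 1 = n 3 then [[yC (n 3), zC (n 3), wC (n 3 + 1)]] else []).map
      (List.filter fun p => 1 ≤ p.2 ∧ p.2 ≤ n p.1)) f = f := by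
  split_ifs with h
  · have h₃ : n 3 = 0 := by omega
    have h₀ : 1 ≤ n 0 := by omega
    simp [h₃, h₀, runNetwork, applySorter_singleton]
  · rfl

/-- Of all sorters, only the third correction can lose places. For the last one, `k % 4 = 3` makes
`k / 3` larger than `k / 4`, which supplies `h₃`. -/
theorem exists_of_mem_correction {n : Fin 4 → ℕ} {k : ℕ} (h₁ : n 1 ≤ n 0) (h₂ : n 3 ≤ n 2)
    (h₃ : k % 4 = 3 → n 0 > n 3 + 1 → n 3 + 1 ≤ n 2) {ps : List (Fin 4 × ℕ)}
    (hps : ps ∈ ((List.range' 1 (min (n 0 - 2) (n 3))).map fun j => [zC j, wC (j + 2)]) ∨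
      ps ∈ ((List.range' 1 (min (n 1 - 1) (n 3))).map
        fun j => [yC j, zC j, wC (j + 1), xC (j + 1)]) ∨
      ps ∈ (if k % 4 = 3 ∧ n 0 > n 3 + 1 then [[yC (n 3 + 1), wC (n 3 + 2)]] else [])) :
    ∀ p ∈ ps, 1 ≤ p.2 ∧ p.2 ≤ n p.1 := by
  rcases hps with hps | hps | hps
  · simp only [List.mem_map, List.mem_range'_1] at hps
    obtain ⟨j, hj, rfl⟩ := hps
    simp
    omega
  · simp only [List.mem_map, List.mem_range'_1] at hps
    obtain ⟨j, hj, rfl⟩ := hps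
    simp
    omega
  · split_ifs at hps with hc
    · rw [List.mem_singleton] at hps
      subst hps
      have := h₃ hc.1 hc.2
      simp
      omega
    · simp at hps

/-- The target counts are determined by their sum, being non-increasing with spread at most 1. If
`a₁ = a₄ + 2`, there are at least `4 * a₄ + 3` ones: either `k ≥ 4 * a₄ + 4` and the row sorter at
`j = a₄ + 1` exists and finishes, or `k = 4 * a₄ + 3`, the counts are forced, and the last sorter
moves the one at `w_{a₄+2}` to `y_{a₄+1}`. -/
theorem runNetwork_correction_rows_yw {c k a₁ a₂ a₃ a₄ b₁ b₂ b₃ b₄ : ℕ} (hk : k ≤ 4 * c)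
    (A : Balanced c k 1 a₁ a₂ a₃ a₄) (h : a₁ ≤ a₄ + 2)
    (hs : b₁ + b₂ + b₃ + b₄ = a₁ + a₂ + a₃ + a₄)
    (b₁₂ : b₂ ≤ b₁) (b₂₃ : b₃ ≤ b₂) (b₃₄ : b₄ ≤ b₃) (b₄₁ : b₁ ≤ b₄ + 1) :
    runNetwork (if k % 4 = 3 ∧ min c k > min c (k / 4) + 1 then
      [[yC (min c (k / 4) + 1), wC (min c (k / 4) + 2)]] else [])
      (runNetwork ((List.range' 1 (min (min c (k / 2) - 1) (min c (k / 4)))).map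
        fun j => [yC j, zC j, wC (j + 1), xC (j + 1)]) (columnState a₁ a₂ a₃ a₄)) =
      columnState b₁ b₂ b₃ b₄ := by
  obtain ⟨le₂, le₃, le₄, le_c, sum_le, gap₂, gap₃, gap₄⟩ := A
  by_cases hc : a₁ = a₄ + 2 ∧ a₂ = a₄ + 1 ∧ a₃ = a₄ ∧ k = 4 * a₄ + 3
  · obtain ⟨rfl, rfl, rfl, hc⟩ := hc
    rw [runNetwork_correction_rows hk (Or.inr (Or.inl ⟨rfl, rfl, rfl, rfl, rfl, rfl, rfl, hc⟩))]
    clear gap₂ gap₃ gap₄ le₂ le₃ le₄ hk sum_le h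
    refine runNetwork_correction_yw (Or.inr ⟨?_, ?_, ?_, ?_, rfl, rfl, hc, le_c⟩) <;> omega
  -- Equal sums give `4 * b₁ - 3 ≤ 4 * a₁`.
  · have hb : b₁ ≤ a₁ := by omega
    have key : runNetwork ((List.range' 1 (min (min c (k / 2) - 1) (min c (k / 4)))).map
        fun j => [yC j, zC j, wC (j + 1), xC (j + 1)]) (columnState a₁ a₂ a₃ a₄) =
        columnState b₁ b₂ b₃ b₄ := by
      by_cases h' : a₁ ≤ a₄ + 1
      · obtain ⟨rfl, rfl, rfl, rfl⟩ : b₁ = a₁ ∧ b₂ = a₂ ∧ b₃ = a₃ ∧ b₄ = a₄ := by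
          clear hc hk gap₂ gap₃ gap₄ le_c sum_le
          refine ⟨?_, ?_, ?_, ?_⟩ <;> omega
        exact runNetwork_correction_rows hk
          (Or.inl ⟨rfl, rfl, rfl, rfl, le₄, le₃, le₂, h'⟩)
      · obtain rfl : a₁ = a₄ + 2 := by omega
        have : 4 * a₄ + 4 ≤ k := by omega
        have e₂ : a₂ = a₄ + 1 ∨ a₂ = a₄ + 2 := by omega
        have e₃ : a₃ = a₄ ∨ a₃ = a₄ + 1 := by omega
        exact runNetwork_correction_rows hk
          (Or.inr (Or.inr ⟨this, le_c, rfl, e₂, e₃, gap₃, hs, b₃₄, b₂₃, b₁₂, b₄₁⟩))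
    rw [key]
    exact runNetwork_correction_yw
      (Or.inl ⟨rfl, rfl, rfl, rfl, hs ▸ sum_le, b₃₄, b₂₃, b₁₂, b₄₁, hb.trans le_c⟩)

/-- These are the column counts when `N` ones fill the grid row by row; the `3` is `4 - 1`, as rows
start at 1 and the inequality is not strict. -/
theorem columnState_div_four (N : ℕ) :
    columnState ((N + 3) / 4) ((N + 2) / 4) ((N + 1) / 4) (N / 4) =
      fun p => decide (4 * p.2 + p.1 ≤ N + 3) := by
  funext ⟨i, r⟩
  rw [Bool.eq_iff_iff, decide_eq_true_iff]
  fin_cases i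
  · exact columnState_zero.trans (by simp; omega)
  · exact columnState_one.trans (by simp; omega)
  · exact columnState_two.trans (by simp; omega)
  · exact columnState_three.trans (by simp; omega)

theorem sum_div_four (N : ℕ) : (N + 3) / 4 + (N + 2) / 4 + (N + 1) / 4 + N / 4 = N := by
  omega

/-- Correction sorts zero-one tuples whose adjacent columns differ by at most one. -/
theorem runNetwork_corrections {c k a₁ a₂ a₃ a₄ N : ℕ} (hk : k ≤ 4 * c)
    (A : Balanced c k 1 a₁ a₂ a₃ a₄) (hN : N = a₁ + a₂ + a₃ + a₄) :
    runNetwork (if k % 4 = 3 ∧ min c k > min c (k / 4) + 1 then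
      [[yC (min c (k / 4) + 1), wC (min c (k / 4) + 2)]] else [])
      (runNetwork ((List.range' 1 (min (min c (k / 2) - 1) (min c (k / 4)))).map
        fun j => [yC j, zC j, wC (j + 1), xC (j + 1)])
        (runNetwork ((List.range' 1 (min (min c k - 2) (min c (k / 4)))).map
          fun j => [zC j, wC (j + 2)]) (columnState a₁ a₂ a₃ a₄))) =
      fun p => decide (4 * p.2 + p.1 ≤ N + 3) := by
  rw [runNetwork_correction_zw hk A, ← columnState_div_four]
  obtain ⟨le₂, le₃, le₄, le_c, sum_le, gap₂, gap₃, gap₄⟩ := A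
  have key : ∀ a₁' a₄', a₁' + a₂ + a₃ + a₄' = a₁ + a₂ + a₃ + a₄ →
      Balanced c k 1 a₁' a₂ a₃ a₄' → a₁' ≤ a₄' + 2 → _ := fun a₁' a₄' hs A' h' =>
    runNetwork_correction_rows_yw hk A' h' (((sum_div_four N).trans hN).trans hs.symm)
      (Nat.div_le_div_right (by omega)) (Nat.div_le_div_right (by omega))
      (Nat.div_le_div_right (by omega)) (by clear * -; omega)
  -- Here every gap is exactly 1: `(t+3, t+2, t+1, t)` has become `(t+2, t+2, t+1, t+1)`.
  by_cases h : a₁ = a₄ + 3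
  · rw [show min a₁ (a₄ + 2) = a₄ + 2 by omega, show max a₄ (a₁ - 2) = a₄ + 1 by omega]
    refine key _ _ ?_ ⟨?_, ?_, ?_, ?_, ?_, ?_, ?_, ?_⟩ ?_ <;> clear key <;> omega
  · rw [show min a₁ (a₄ + 2) = a₁ by omega, show max a₄ (a₁ - 2) = a₄ by omega]
    exact key _ _ rfl ⟨le₂, le₃, le₄, le_c, sum_le, gap₂, gap₃, gap₄⟩ (by omega)

/-! ### The whole network on zero-one tuples. -/

/-- On a zero-one tuple with at most `k` ones the network sorts in row-major order. -/
theorem runNetwork_filter_columnState {c k a₁ a₂ a₃ a₄ : ℕ} {n : Fin 4 → ℕ} (hk : k ≤ 4 * c)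
    (n₀ : n 0 = min c k) (n₁ : n 1 = min c (k / 2)) (n₂ : n 2 = min c (k / 3))
    (n₃ : n 3 = min c (k / 4)) (le₂ : a₂ ≤ a₁) (le₃ : a₃ ≤ a₂) (le₄ : a₄ ≤ a₃) (le_c : a₁ ≤ c)
    (sum_le : a₁ + a₂ + a₃ + a₄ ≤ k) :
    runNetwork ((slopePhase (n 0) (n 1) (n 2) (n 3) (Nat.clog 2 (n 0)) ++
        correctionPhase (n 0) (n 1) (n 3) k).map
        (List.filter fun p => 1 ≤ p.2 ∧ p.2 ≤ n p.1)) (columnState a₁ a₂ a₃ a₄) =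
      fun p => decide (4 * p.2 + p.1 ≤ a₁ + a₂ + a₃ + a₄ + 3) := by
  -- The initial step bounds `a₁` itself, hence every initial gap.
  have hpow : n 0 ≤ 2 ^ Nat.clog 2 (n 0) := Nat.le_pow_clog (by omega) _
  have le_n : a₁ ≤ n 0 := by rw [n₀]; omega
  have H : Balanced c k (2 ^ Nat.clog 2 (n 0)) a₁ a₂ a₃ a₄ :=
    ⟨le₂, le₃, le₄, le_c, sum_le, by omega, by omega, by omega⟩
  obtain ⟨b₁, b₂, b₃, b₄, B, hs, e⟩ := runNetwork_slopePhase hk H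
  rw [← n₀, ← n₁, ← n₂, ← n₃] at e
  have hmem := @exists_of_mem_correction n k (by rw [n₀, n₁]; clear * -; omega)
    (by rw [n₂, n₃]; clear * -; omega) (by rw [n₀, n₂, n₃]; clear * -; omega)
  rw [correctionPhase, List.map_append, List.map_append, List.map_append, List.map_append,
    runNetwork_append, runNetwork_append, runNetwork_append, runNetwork_append,
    runNetwork_correction_yzw n₀ n₁ n₃,
    map_filter_eq_self fun ps hps p hp => decide_eq_true (exists_of_mem_slopePhase hps p hp),
    map_filter_eq_self fun ps hps p hp => decide_eq_true (hmem (Or.inl hps) p hp),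
    map_filter_eq_self fun ps hps p hp => decide_eq_true (hmem (Or.inr (Or.inl hps)) p hp),
    map_filter_eq_self fun ps hps p hp => decide_eq_true (hmem (Or.inr (Or.inr hps)) p hp),
    e, n₀, n₁, n₃]
  exact runNetwork_corrections hk B hs.symm

/-- On a zero-one tuple with at most `k` ones the network sorts in row-major order. -/
theorem runNetwork_fourWiseNetwork {c k a₁ a₂ a₃ a₄ : ℕ} (hk : k ≤ 4 * c) (le₂ : a₂ ≤ a₁)
    (le₃ : a₃ ≤ a₂) (le₄ : a₄ ≤ a₃) (le_c : a₁ ≤ c) (sum_le : a₁ + a₂ + a₃ + a₄ ≤ k)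
    (p : Wire fun i : Fin 4 => colLen c k i) :
    runNetwork (fourWiseNetwork (fun i => colLen c k i) k)
      (columnState a₁ a₂ a₃ a₄ ∘ place _) p = true ↔
      4 * p.2.val + p.1.val < a₁ + a₂ + a₃ + a₄ := by
  have h := runNetwork_filter_columnState (n := fun i => colLen c k i) hk (by simp [colLen])
    (by simp [colLen]) (by simp [colLen]) (by simp [colLen]) le₂ le₃ le₄ le_c sum_le
  rw [← runNetwork_map (place_injective _), fourWiseNetwork, List.map_map]
  have e : (List.map (place fun i : Fin 4 => colLen c k i) ∘ toWires fun i => colLen c k i) =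
      List.filter fun p : Fin 4 × ℕ => 1 ≤ p.2 ∧ p.2 ≤ colLen c k p.1 :=
    funext fun l => map_place_toWires _ l
  rw [e, h]
  refine (decide_eq_true_iff (p := 4 * (p.2.val + 1) + p.1.val ≤ a₁ + a₂ + a₃ + a₄ + 3)).trans ?_
  omega

/-! ### From zero-one tuples to arbitrary values. -/

theorem exists_eq_lt_of_antitone {m : ℕ} {P : Fin m → Prop}
    (hP : ∀ i j : Fin m, i ≤ j → P j → P i) :
    ∃ a ≤ m, ∀ j : Fin m, P j ↔ j.val < a := by
  classical
  have hex : ∃ a, ∀ h : a < m, ¬ P ⟨a, h⟩ := ⟨m, fun h => absurd h (lt_irrefl m)⟩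
  refine ⟨Nat.find hex, Nat.find_min' hex fun h => absurd h (lt_irrefl m), fun j => ⟨fun hj => ?_,
    fun hj => ?_⟩⟩
  · by_contra hlt
    have hle : Nat.find hex ≤ j.val := not_lt.1 hlt
    exact Nat.find_spec hex (hle.trans_lt j.2) (hP ⟨_, hle.trans_lt j.2⟩ j hle hj)
  · have := Nat.find_min hex hj
    push Not at this
    exact this.2

/-- The threshold of an `m`-wise tuple is given by non-increasing numbers of ones. -/
theorem IsMWise.exists_threshold {α : Type*} [LinearOrder α] {c k : ℕ}
    {x : (i : Fin 4) → Fin (colLen c k i) → α} (hx : IsMWise c k x) (θ : α) :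
    ∃ a₁ a₂ a₃ a₄, a₂ ≤ a₁ ∧ a₃ ≤ a₂ ∧ a₄ ≤ a₃ ∧ a₁ ≤ c ∧
      (fun p : Wire fun i : Fin 4 => colLen c k i => decide (θ ≤ x p.1 p.2)) =
        columnState a₁ a₂ a₃ a₄ ∘ place _ := by
  have hcol : ∀ i, ∃ a ≤ colLen c k i, ∀ j, θ ≤ x i j ↔ j.val < a := fun i =>
    exists_eq_lt_of_antitone fun j j' hj h => h.trans (hx.sorted i hj)
  choose a ha ha' using hcol
  have hrow : ∀ i i' : Fin 4, i'.val = i.val + 1 → a i' ≤ a i := by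
    intro i i' hi
    -- Otherwise the entry at index `a i` is at least `θ` in the right column, so also in the left
    -- one, where it lies past the threshold.
    by_contra hlt
    have hlt : a i < a i' := not_le.1 hlt
    have h' : a i < colLen c k i' := hlt.trans_le (ha i')
    have h : a i < colLen c k i := by
      have : colLen c k i' ≤ colLen c k i :=
        min_le_min_left c (Nat.div_le_div_left (by omega) (by omega))
      omega
    have h₁ := (ha' i' ⟨a i, h'⟩).2 hlt
    exact lt_irrefl _ ((ha' i ⟨a i, h⟩).1 (h₁.trans (hx.rows i i' hi _ h h')))
  refine ⟨a 0, a 1, a 2, a 3, hrow 0 1 rfl, hrow 1 2 rfl, hrow 2 3 rfl,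
    (ha 0).trans (min_le_left _ _), ?_⟩
  funext ⟨i, j⟩
  rw [Bool.eq_iff_iff, decide_eq_true_iff, ha']
  have : ![a 0, a 1, a 2, a 3] i = a i := by fin_cases i <;> rfl
  refine Iff.trans ?_ (decide_eq_true_iff (p := j.val + 1 ≤ ![a 0, a 1, a 2, a 3] i)).symm
  rw [this]
  exact Nat.lt_iff_add_one_le

/-- A diagram of at least `k` cells contains one of exactly `k` cells. -/
theorem exists_subdiagram {k a₁ a₂ a₃ a₄ : ℕ} (le₂ : a₂ ≤ a₁) (le₃ : a₃ ≤ a₂) (le₄ : a₄ ≤ a₃)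
    (hk : k ≤ a₁ + a₂ + a₃ + a₄) :
    ∃ b₁ b₂ b₃ b₄, b₂ ≤ b₁ ∧ b₃ ≤ b₂ ∧ b₄ ≤ b₃ ∧ b₁ ≤ a₁ ∧ b₂ ≤ a₂ ∧ b₃ ≤ a₃ ∧ b₄ ≤ a₄ ∧
      b₁ + b₂ + b₃ + b₄ = k := by
  by_cases h₁ : k ≤ a₁
  · exact ⟨k, 0, 0, 0, by omega⟩
  by_cases h₂ : k ≤ a₁ + a₂
  · exact ⟨a₁, k - a₁, 0, 0, by omega⟩
  by_cases h₃ : k ≤ a₁ + a₂ + a₃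
  · exact ⟨a₁, a₂, k - a₁ - a₂, 0, by omega⟩
  · exact ⟨a₁, a₂, a₃, k - a₁ - a₂ - a₃, by omega⟩

/-- Among the first `k` places in row-major order, the output of the network is non-increasing
towards all later places. -/
theorem IsMWise.runNetwork_le {α : Type*} [LinearOrder α] {c k : ℕ}
    {x : (i : Fin 4) → Fin (colLen c k i) → α} (hx : IsMWise c k x)
    {p q : Wire fun i : Fin 4 => colLen c k i}
    (hpq : 4 * p.2.val + p.1.val < 4 * q.2.val + q.1.val) (hp : 4 * p.2.val + p.1.val < k) :
    runNetwork (fourWiseNetwork (fun i => colLen c k i) k) (fun p => x p.1 p.2) q ≤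
      runNetwork (fourWiseNetwork (fun i => colLen c k i) k) (fun p => x p.1 p.2) p := by
  by_contra! hlt
  have hk := hx.le_mul
  -- Cutting at the output value of `q` itself puts a one at `q` and a zero at `p`.
  obtain ⟨θ, hθ⟩ : ∃ θ, θ = runNetwork (fourWiseNetwork (fun i => colLen c k i) k)
    (fun p => x p.1 p.2) q := ⟨_, rfl⟩
  rw [← hθ] at hlt
  obtain ⟨a₁, a₂, a₃, a₄, le₂, le₃, le₄, le_c, ha⟩ := hx.exists_threshold θ
  have hg : Monotone fun y : α => decide (θ ≤ y) := by
    intro y y' hy h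
    simp only [decide_eq_true_eq] at h ⊢
    exact h.trans hy
  have hrun := runNetwork_monotone_comp hg (fourWiseNetwork (fun i => colLen c k i) k)
    (fun p => x p.1 p.2)
  have ha' : (fun y : α => decide (θ ≤ y)) ∘
      (fun p : Wire fun i : Fin 4 => colLen c k i => x p.1 p.2) =
      columnState a₁ a₂ a₃ a₄ ∘ place _ := ha
  rw [ha'] at hrun
  have hq₁ := congrFun hrun q
  have hp₁ := congrFun hrun p
  simp only [Function.comp_apply (f := fun y : α => decide (θ ≤ y)), ← hθ, le_refl,
    decide_true, decide_eq_false (not_le.2 hlt)] at hq₁ hp₁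
  by_cases hsum : a₁ + a₂ + a₃ + a₄ ≤ k
  · have hq₂ := (runNetwork_fourWiseNetwork hk le₂ le₃ le₄ le_c hsum q).1 hq₁
    have := (runNetwork_fourWiseNetwork hk le₂ le₃ le₄ le_c hsum p).2 (hpq.trans hq₂)
    simp [hp₁] at this
  · obtain ⟨b₁, b₂, b₃, b₄, le₂', le₃', le₄', l₁, l₂, l₃, l₄, hb⟩ :=
      exists_subdiagram le₂ le₃ le₄ (not_le.1 hsum).le
    have := runNetwork_bool_mono _ (v := columnState a₁ a₂ a₃ a₄ ∘ place _) (fun r => ?_) p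
      ((runNetwork_fourWiseNetwork hk le₂' le₃' le₄' (l₁.trans le_c) hb.le p).2 (hb ▸ hp))
    · simp [hp₁] at this
    · have hle : ∀ i, ![b₁, b₂, b₃, b₄] i ≤ ![a₁, a₂, a₃, a₄] i := by
        intro i
        fin_cases i <;> assumption
      simp only [Function.comp_apply, columnState, decide_eq_true_eq]
      exact fun h => h.trans (hle _)

/-! ### Row-major output. -/

/-- The places of a tuple of four columns in row-major order. -/
def rowMajor (n : Fin 4 → ℕ) : List (Wire n) :=
  (List.range (n 0)).flatMap fun j => (List.finRange 4).filterMap fun i =>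
    if h : j < n i then some ⟨i, ⟨j, h⟩⟩ else none

theorem zipCols_eq_map_rowMajor {α : Type*} (n : Fin 4 → ℕ) (f : Wire n → α) :
    zipCols ((List.finRange 4).map fun i => List.ofFn fun j => f ⟨i, j⟩) =
      (rowMajor n).map f := by
  have h : (((List.finRange 4).map fun i => List.ofFn fun j => f ⟨i, j⟩).headD []).length =
      n 0 := by
    simp [List.finRange_succ]
  rw [zipCols, h, rowMajor, List.map_flatMap]
  congr 1
  funext j
  rw [List.filterMap_map, List.map_filterMap]
  congr 1
  funext i
  by_cases h : j < n i <;> simp [h]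

theorem mem_rowMajor {n : Fin 4 → ℕ} {p : Wire n} (hn : n p.1 ≤ n 0) : p ∈ rowMajor n := by
  obtain ⟨i, j, hj⟩ := p
  simp only [rowMajor, List.mem_flatMap, List.mem_range, List.mem_filterMap]
  exact ⟨j, hj.trans_le hn, i, List.mem_finRange i, by simp [hj]⟩

theorem pairwise_rowMajor (n : Fin 4 → ℕ) : (rowMajor n).Pairwise
    fun p q => 4 * p.2.val + p.1.val < 4 * q.2.val + q.1.val := by
  rw [rowMajor, List.pairwise_flatMap]
  refine ⟨fun j _ => ?_, ?_⟩
  · rw [List.pairwise_filterMap]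
    refine (List.pairwise_lt_finRange 4).imp fun {i i'} hi p hp q hq => ?_
    split_ifs at hp hq
    simp only [Option.some.injEq] at hp hq
    subst hp hq
    simpa using hi
  · refine List.pairwise_lt_range.imp fun {j j'} hj p hp q hq => ?_
    simp only [List.mem_filterMap] at hp hq
    obtain ⟨i, -, hi⟩ := hp
    obtain ⟨i', -, hi'⟩ := hq
    split_ifs at hi hi'
    simp only [Option.some.injEq] at hi hi'
    subst hi hi'
    simp only
    omega

/-- Increasing keys that attain every value below `k` make the first `k` entries precisely those
with key below `k`. -/
theorem topKSorted_map {ι α : Type*} [LinearOrder α] {l : List ι} {key : ι → ℕ} {f : ι → α} {k : ℕ}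
    (hl : l.Pairwise fun p q => key p < key q) (hk : ∀ t < k, ∃ p ∈ l, key p = t)
    (hf : ∀ p q, key p < key q → key p < k → f q ≤ f p) : TopKSorted k (l.map f) := by
  have hlen : k ≤ (l.filter fun p => key p < k).length := by
    have hsub : List.range k ⊆ (l.filter fun p => key p < k).map key := by
      intro t ht
      obtain ⟨p, hp, rfl⟩ := hk t (List.mem_range.1 ht)
      exact List.mem_map_of_mem (List.mem_filter.2 ⟨hp, by simpa using ht⟩)
    simpa using ((List.nodup_range).subperm hsub).length_le
  have hlen' : k ≤ l.length := hlen.trans (List.length_filter_le _ _)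
  have htake : ∀ p ∈ l.take k, key p < k := by
    by_contra! hcon
    obtain ⟨p, hp, hpk⟩ := hcon
    -- A key of at least `k` among the first `k` entries pushes all later keys above `k`, leaving
    -- fewer than `k` entries with key below `k`.
    have hdrop : (l.drop k).filter (fun p => key p < k) = [] := by
      rw [List.filter_eq_nil_iff]
      intro q hq
      rw [← List.take_append_drop k l, List.pairwise_append] at hl
      have := hl.2.2 p hp q hq
      simp
      omega
    have hlt : ((l.take k).filter fun p => key p < k).length < (l.take k).length :=
      List.length_filter_lt_length_iff_exists.2 ⟨p, hp, by simpa using hpk⟩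
    have := congrArg List.length (List.filter_append (p := fun p => decide (key p < k))
      (l.take k) (l.drop k))
    rw [List.take_append_drop, hdrop, List.append_nil] at this
    rw [List.length_take] at hlt
    omega
  rw [← List.take_append_drop k l, List.pairwise_append] at hl
  refine ⟨by simpa using hlen', ?_, ?_⟩
  · rw [← List.map_take, List.pairwise_map]
    exact hl.1.imp_of_mem fun {p q} hp _ h => hf p q h (htake p hp)
  · rw [← List.map_take, ← List.map_drop]
    simp only [List.mem_map]
    rintro _ ⟨p, hp, rfl⟩ _ ⟨q, hq, rfl⟩
    exact hf p q (hl.2.2 p hp q hq) (htake p hp)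

end MergeNet

theorem mainTheorem3 {α : Type*} [LinearOrder α] (c k : ℕ)
    (x : (i : Fin 4) → Fin (MergeNet.colLen c k i) → α) (hx : MergeNet.IsMWise c k x) :
    MergeNet.TopKSorted k (MergeNet.fourWiseMerge c k x) := by
  have hk := hx.le_mul
  rw [MergeNet.fourWiseMerge, MergeNet.zipCols_eq_map_rowMajor]
  refine MergeNet.topKSorted_map (key := fun p => 4 * p.2.val + p.1.val)
    (MergeNet.pairwise_rowMajor _) (fun t ht => ?_) (fun p q h h' => hx.runNetwork_le h h')
  -- No place is skipped among the first `k`, so there the key is the true output position.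
  have hlt : t / 4 < MergeNet.colLen c k (⟨t % 4, Nat.mod_lt _ (by omega)⟩ : Fin 4) := by
    have hr : t % 4 < 4 := Nat.mod_lt _ (by omega)
    have ht' : 4 * (t / 4) + t % 4 = t := Nat.div_add_mod t 4
    -- With `t = 4 * m + r` and `r ≤ 3`, `(m + 1) * (r + 1) ≤ 4 * m + r + 1 = t + 1 ≤ k`.
    have hmul : (t / 4 + 1) * (t % 4 + 1) ≤ k := by
      generalize t % 4 = r at *
      generalize t / 4 = m at *
      nlinarith
    exact lt_min (by omega) ((Nat.le_div_iff_mul_le (Nat.succ_pos _)).2 hmul)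
  refine ⟨⟨⟨t % 4, Nat.mod_lt _ (by omega)⟩, ⟨t / 4, hlt⟩⟩, MergeNet.mem_rowMajor ?_, ?_⟩
  · exact min_le_min_left c (Nat.div_le_div_left (by simp) (by simp))
  · exact Nat.div_add_mod t 4
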